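/- Let $\Delta$ be the discrete Laplacian on $\ell^2(\mathbb Z^2)$, $(\Delta u)(n)=\sum_{j=1}^{2}\bigl(u(n-b_j)+u(n+b_j)\bigr)$, where $b_1,b_2$ is the standard basis of $\mathbb Z^2$. A function $V:\mathbb Z^2\to\mathbb R$ is called $(p,q)$-periodic if $V(n+p\,b_1)=V(n)$ and $V(n+q\,b_2)=V(n)$ for all $n\in\mathbb Z^2$; it acts on $\ell^2(\mathbb Z^2)$ by multiplication, and $\|V\|_\infty=\sup_{n}|V(n)|$. Theorem (discrete Bethe--Sommerfeld). Let $p,q\ge 2$ be coprime integers. Then there exists $\delta=\delta(p,q)>0$ such that for every $(p,q)$-periodic $V:\mathbb Z^2\to\mathbb R$ with $\|V\|_\infty\le\delta$, the spectrum $\sigma(\Delta+V)$ is an interval, that is, $\sigma(\Delta+V)=[a,b]$ for some real numbers $a<b$. -/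

import Mathlib

open scoped ENNReal lp

noncomputable section

namespace BetheSommerfeld

/-- The Hilbert space `ℓ²(ℤ²)` of square summable complex functions on `ℤ²`. -/
abbrev L2 : Type := ℓ²(ℤ × ℤ, ℂ)

/-- The space `ℓ^∞(ℤ²)` of bounded real functions on `ℤ²`, with the supremum norm. -/
abbrev LInf : Type := ℓ^∞(ℤ × ℤ, ℝ)

/-- `V` is `(p, q)`-periodic: `V(n + p b₁) = V(n)` and `V(n + q b₂) = V(n)` for all `n ∈ ℤ²`. -/
def IsPeriodic (p q : ℕ) (V : ℤ × ℤ → ℝ) : Prop :=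
  ∀ n : ℤ × ℤ, V (n + ((p : ℤ), 0)) = V n ∧ V (n + (0, (q : ℤ))) = V n

theorem IsPeriodic.eq_mod {p q : ℕ} {V : ℤ × ℤ → ℝ} (hV : IsPeriodic p q V) (n : ℤ × ℤ) :
    V n = V (n.1 % p, n.2 % q) := by
  have h1 : ∀ b : ℤ, Function.Periodic (fun a : ℤ => V (a, b)) (p : ℤ) := fun b a => by
    simpa using (hV (a, b)).1
  have h2 : ∀ a : ℤ, Function.Periodic (fun b : ℤ => V (a, b)) (q : ℤ) := fun a b => by
    simpa using (hV (a, b)).2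
  obtain ⟨a, b⟩ := n
  have e1 := (h1 b).sub_zsmul_eq (a / (p : ℤ)) (x := a)
  have e2 := (h2 (a % p)).sub_zsmul_eq (b / (q : ℤ)) (x := b)
  have r1 : a - (a / (p : ℤ)) • (p : ℤ) = a % p := by
    rw [smul_eq_mul, Int.emod_def, mul_comm]
  have r2 : b - (b / (q : ℤ)) • (q : ℤ) = b % q := by
    rw [smul_eq_mul, Int.emod_def, mul_comm]
  simp only [r1] at e1
  simp only [r2] at e2
  rw [e2, e1]

/-- A periodic function is bounded. -/
theorem IsPeriodic.memℓp {p q : ℕ} (hp : 0 < p) (hq : 0 < q) {V : ℤ × ℤ → ℝ}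
    (hV : IsPeriodic p q V) : Memℓp V ∞ := by
  refine memℓp_infty ?_
  have hfin : ((fun n : ℤ × ℤ => ‖V n‖) ''
      (Set.Ico (0 : ℤ) p ×ˢ Set.Ico (0 : ℤ) q)).Finite :=
    ((Set.finite_Ico _ _).prod (Set.finite_Ico _ _)).image _
  refine hfin.bddAbove.mono ?_
  rintro _ ⟨n, rfl⟩
  have hp' : (0 : ℤ) < p := by exact_mod_cast hp
  have hq' : (0 : ℤ) < q := by exact_mod_cast hq
  exact ⟨(n.1 % p, n.2 % q),
    ⟨⟨Int.emod_nonneg _ hp'.ne', Int.emod_lt_of_pos _ hp'⟩,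
      ⟨Int.emod_nonneg _ hq'.ne', Int.emod_lt_of_pos _ hq'⟩⟩, by
        simp only [← hV.eq_mod n]⟩

/-- A periodic function, as an element of `ℓ^∞(ℤ²)`. -/
def IsPeriodic.toLInf {p q : ℕ} (hp : 0 < p) (hq : 0 < q) {V : ℤ × ℤ → ℝ}
    (hV : IsPeriodic p q V) : LInf :=
  ⟨V, hV.memℓp hp hq⟩

/-- The translation operator `(translation v u)(n) = u(n + v)` on `ℓ²(ℤ²)`. -/
def translation (v : ℤ × ℤ) : L2 →L[ℂ] L2 :=
  LinearMap.mkContinuous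
    { toFun := fun u => ⟨fun n => u (n + v), memℓp_gen
        ((Equiv.addRight v).summable_iff.mpr ((lp.memℓp u).summable (by norm_num)))⟩
      map_add' := fun _ _ => rfl
      map_smul' := fun _ _ => rfl }
    1 fun u => by
      rw [one_mul]
      refine lp.norm_le_of_tsum_le (by norm_num) (norm_nonneg u) ?_
      rw [lp.norm_rpow_eq_tsum (by norm_num) u]
      exact ((Equiv.addRight v).tsum_eq
        (fun n => ‖u n‖ ^ (2 : ℝ≥0∞).toReal)).le

@[simp]
theorem translation_apply (v : ℤ × ℤ) (u : L2) (n : ℤ × ℤ) : translation v u n = u (n + v) := rfl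

/-- The discrete Laplacian `(Δu)(n) = ∑ⱼ (u(n - bⱼ) + u(n + bⱼ))` on `ℓ²(ℤ²)`. -/
def laplacian : L2 →L[ℂ] L2 :=
  (translation (-(1, 0)) + translation (1, 0)) + (translation (-(0, 1)) + translation (0, 1))

theorem laplacian_apply (u : L2) (n : ℤ × ℤ) :
    laplacian u n =
      (u (n - (1, 0)) + u (n + (1, 0))) + (u (n - (0, 1)) + u (n + (0, 1))) := rfl

/-- The operator of multiplication by the bounded real function `V` on `ℓ²(ℤ²)`. -/
def multiplication (V : LInf) : L2 →L[ℂ] L2 :=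
  lp.mapCLM 2 (fun n => (V n : ℂ) • ContinuousLinearMap.id ℂ ℂ) (norm_nonneg V) fun n => by
    rw [norm_smul, ContinuousLinearMap.norm_id, mul_one, Complex.norm_real]
    exact lp.norm_apply_le_norm ENNReal.top_ne_zero V n

theorem multiplication_apply (V : LInf) (u : L2) (n : ℤ × ℤ) :
    multiplication V u n = (V n : ℂ) * u n := rfl

/-- The discrete Schrödinger operator `Δ + V` on `ℓ²(ℤ²)`. -/
def schrodinger (V : LInf) : L2 →L[ℂ] L2 := laplacian + multiplication V

end BetheSommerfeld

end

noncomputable section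

namespace BetheSommerfeld

/-! Energies of Bloch waves lie in the spectrum: a bounded solution damped by a slowly decaying
weight is an approximate eigenvector (`IsBoundedEigenfunction.mem_spectrum`). It remains to bound
the spectrum and to fill the interval between the bounds with Bloch energies.

In the interior, the free determinant at energy μ is the product of the factors `freeEnergy p q k s
- μ`. Coprimality makes the two shift angles belonging to a nonzero `s` have different cosines. The
translated level curve then meets the original at only finitely many values of `cos x`, so for μ in
(-4, 4) some point of the curve annihilates exactly one factor. Crossing the curve there changes the
sign of the determinant. Both signs survive small changes of the potential and of μ, the determinant
is real, and the intermediate value theorem in k yields a zero. Compactness makes this uniform on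
[-m, m] with m < 4 (`eventually_isBoundedEigenfunction`).

Near the edges the sign argument is not uniform. There the largest Bloch eigenvalue is followed in
k: at (π/p, 0) it is below m for small potentials, and at k = 0 it bounds the whole spectrum from
above (`mem_Icc_of_mem_spectrum`). Continuity fills the range between. The lower edge follows by
negating the operator through an alternating sign. -/

/-! ### Bounded solutions and approximate eigenvectors -/

/-- The weight `r ^ (|n₁| + |n₂|)` on `ℤ²`. -/
def expWeight (r : ℝ) (n : ℤ × ℤ) : ℝ := r ^ (n.1.natAbs + n.2.natAbs)

theorem summable_pow_natAbs {s : ℝ} (h0 : 0 ≤ s) (h1 : s < 1) :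
    Summable fun n : ℤ => s ^ n.natAbs := by
  refine Summable.of_nat_of_neg ?_ ?_ <;> simpa using summable_geometric_of_lt_one h0 h1

theorem summable_expWeight_sq {r : ℝ} (h0 : 0 < r) (h1 : r < 1) :
    Summable fun n => expWeight r n ^ 2 := by
  have hs : r ^ 2 < 1 := by nlinarith
  have h := summable_pow_natAbs (sq_nonneg r) hs
  refine (h.mul_of_nonneg h (fun _ => by positivity) (fun _ => by positivity)).congr fun n => ?_
  simp only [expWeight]
  ring

theorem abs_pow_sub_pow_le {r : ℝ} (h0 : 0 < r) (h1 : r < 1) {a b : ℕ} (hab : b ≤ a + 1)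
    (hba : a ≤ b + 1) : |r ^ a - r ^ b| ≤ (r⁻¹ - 1) * r ^ a := by
  have hr : r * r⁻¹ = 1 := mul_inv_cancel₀ h0.ne'
  have hr1 : 1 < r⁻¹ := (one_lt_inv₀ h0).2 h1
  have hr2 : 1 - r ≤ r⁻¹ - 1 := by nlinarith
  have hcase : b = a + 1 ∨ b = a ∨ a = b + 1 := by omega
  rcases hcase with rfl | rfl | rfl
  · have ha : 0 < r ^ a := by positivity
    rw [pow_succ, abs_of_nonneg (by nlinarith)]
    linarith [mul_le_mul_of_nonneg_right hr2 ha.le]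
  · simp only [sub_self, abs_zero]
    have : 0 < r ^ b := by positivity
    nlinarith
  · have hb : 0 < r ^ b := by positivity
    rw [pow_succ, abs_sub_comm, abs_of_nonneg (by nlinarith)]
    nlinarith

/-- A step of length at most one changes the exponent by at most one. The relative error `r⁻¹ - 1`
tends to 0 as r → 1. -/
theorem abs_expWeight_sub_le {r : ℝ} (h0 : 0 < r) (h1 : r < 1) (n b : ℤ × ℤ)
    (hb : b.1.natAbs + b.2.natAbs ≤ 1) :
    |expWeight r n - expWeight r (n - b)| ≤ (r⁻¹ - 1) * expWeight r n := by
  refine abs_pow_sub_pow_le h0 h1 ?_ ?_ <;> simp only [Prod.fst_sub, Prod.snd_sub] <;> omega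

theorem norm_translation_le (v : ℤ × ℤ) (u : L2) : ‖translation v u‖ ≤ ‖u‖ := by
  have h := (translation v).le_of_opNorm_le (LinearMap.mkContinuous_norm_le _ zero_le_one _) u
  rwa [one_mul] at h

theorem exists_l2_of_norm_le {η : ℝ} (hη : 0 ≤ η) (f : L2) (g : ℤ × ℤ → ℂ)
    (hg : ∀ n, ‖g n‖ ≤ η * ‖f n‖) : ∃ F : L2, (∀ n, F n = g n) ∧ ‖F‖ ≤ η * ‖f‖ := by
  have hf : ∀ n, ‖g n‖ ≤ ‖((η : ℂ) • f) n‖ := fun n => by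
    rw [lp.coeFn_smul, Pi.smul_apply, norm_smul, Complex.norm_real, Real.norm_of_nonneg hη]
    exact hg n
  have hmem : Memℓp g 2 := by
    refine memℓp_gen ?_
    refine Summable.of_nonneg_of_le (fun _ => by positivity) (fun n => ?_)
      ((lp.memℓp ((η : ℂ) • f)).summable (by norm_num))
    exact Real.rpow_le_rpow (norm_nonneg _) (hf n) (by norm_num)
  refine ⟨⟨g, hmem⟩, fun _ => rfl, ?_⟩
  have h : ‖(⟨g, hmem⟩ : L2)‖ ≤ ‖(η : ℂ) • f‖ := lp.norm_mono (by norm_num) hf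
  rwa [norm_smul, Complex.norm_real, Real.norm_of_nonneg hη] at h

/-- A nonzero bounded solution `u` of `(Δ + V) u = z u` on `ℤ²`. -/
structure IsBoundedEigenfunction (V : ℤ × ℤ → ℝ) (z : ℂ) (u : ℤ × ℤ → ℂ) : Prop where
  bounded : ∃ C : ℝ, ∀ n, ‖u n‖ ≤ C
  ne_zero : ∃ n, u n ≠ 0
  eigen : ∀ n, (u (n - (1, 0)) + u (n + (1, 0))) + (u (n - (0, 1)) + u (n + (0, 1)))
    + (V n : ℂ) * u n = z * u n

/-- Multiplying a bounded solution by an exponential weight gives an approximate eigenvector. -/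
theorem IsBoundedEigenfunction.exists_approx {V : LInf} {z : ℂ} {u : ℤ × ℤ → ℂ}
    (hu : IsBoundedEigenfunction V z u) {r : ℝ} (h0 : 0 < r) (h1 : r < 1) :
    ∃ f : L2, f ≠ 0 ∧ ‖schrodinger V f - z • f‖ ≤ 4 * (r⁻¹ - 1) * ‖f‖ := by
  obtain ⟨C, hC⟩ := hu.bounded
  obtain ⟨n₀, hn₀⟩ := hu.ne_zero
  have hpos : ∀ n, 0 < expWeight r n := fun n => by unfold expWeight; positivity
  have hη : 0 ≤ r⁻¹ - 1 := sub_nonneg.2 ((one_lt_inv₀ h0).2 h1).le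
  have hmem : Memℓp (fun n => u n * (expWeight r n : ℂ)) 2 := by
    refine memℓp_gen ?_
    refine Summable.of_nonneg_of_le (fun _ => by positivity) (fun n => ?_)
      ((summable_expWeight_sq h0 h1).mul_left (C ^ 2))
    have : (2 : ℝ≥0∞).toReal = (2 : ℕ) := by norm_num
    rw [this, Real.rpow_natCast, ← mul_pow, norm_mul, Complex.norm_real,
      Real.norm_of_nonneg (hpos n).le]
    have := hC n
    have := hpos n
    gcongr
  let f : L2 := ⟨fun n => u n * (expWeight r n : ℂ), hmem⟩
  have hf : ∀ n, f n = u n * (expWeight r n : ℂ) := fun _ => rfl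
  have key : ∀ b : ℤ × ℤ, b.1.natAbs + b.2.natAbs ≤ 1 → ∃ F : L2,
      (∀ n, F n = u n * ((expWeight r n - expWeight r (n - b) : ℝ) : ℂ)) ∧
        ‖F‖ ≤ (r⁻¹ - 1) * ‖f‖ := fun b hb => by
    refine exists_l2_of_norm_le hη f _ fun n => ?_
    rw [hf, norm_mul, norm_mul, Complex.norm_real, Complex.norm_real,
      Real.norm_of_nonneg (hpos n).le, Real.norm_eq_abs]
    have := mul_le_mul_of_nonneg_left (abs_expWeight_sub_le h0 h1 n b hb) (norm_nonneg (u n))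
    linarith
  obtain ⟨F₁, e₁, l₁⟩ := key (-(1, 0)) (by simp)
  obtain ⟨F₂, e₂, l₂⟩ := key (1, 0) (by simp)
  obtain ⟨F₃, e₃, l₃⟩ := key (-(0, 1)) (by simp)
  obtain ⟨F₄, e₄, l₄⟩ := key (0, 1) (by simp)
  refine ⟨f, fun h => ?_, ?_⟩
  · have h' : u n₀ * (expWeight r n₀ : ℂ) = 0 := by rw [← hf, h]; rfl
    rcases mul_eq_zero.1 h' with h' | h'
    · exact hn₀ h'
    · exact (hpos n₀).ne' (by exact_mod_cast h')
  -- The eigenvalue equation cancels everything but the commutator of the Laplacian with the weight,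
  -- one translated term for each neighbour.
  · have heq : schrodinger V f - z • f = (translation (-(1, 0)) F₁ + translation (1, 0) F₂) +
        (translation (-(0, 1)) F₃ + translation (0, 1) F₄) := by
      ext n
      have h := hu.eigen n
      have lhs : (schrodinger V f - z • f) n = (f (n - (1, 0)) + f (n + (1, 0))) +
          (f (n - (0, 1)) + f (n + (0, 1))) + (V n : ℂ) * f n - z * f n := rfl
      have rhs : ((translation (-(1, 0)) F₁ + translation (1, 0) F₂) +
          (translation (-(0, 1)) F₃ + translation (0, 1) F₄)) n =
          (F₁ (n - (1, 0)) + F₂ (n + (1, 0))) + (F₃ (n - (0, 1)) + F₄ (n + (0, 1))) := rfl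
      rw [lhs, rhs, e₁, e₂, e₃, e₄]
      simp only [hf, sub_neg_eq_add, sub_add_cancel, add_sub_cancel_right, Complex.ofReal_sub]
      linear_combination (expWeight r n : ℂ) * h
    rw [heq]
    have t := norm_add₄_le (a := translation (-(1, 0)) F₁) (b := translation (1, 0) F₂)
      (c := translation (-(0, 1)) F₃) (d := translation (0, 1) F₄)
    have := norm_translation_le (-(1, 0)) F₁
    have := norm_translation_le (1, 0) F₂
    have := norm_translation_le (-(0, 1)) F₃
    have := norm_translation_le (0, 1) F₄
    rw [← add_assoc]
    linarith

/-- A bounded left inverse R of z - H would force `1 ≤ ‖R‖ * 4 * (r⁻¹ - 1)` for every r < 1, which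
fails as r → 1. -/
theorem IsBoundedEigenfunction.mem_spectrum {V : LInf} {z : ℂ} {u : ℤ × ℤ → ℂ}
    (hu : IsBoundedEigenfunction V z u) : z ∈ spectrum ℂ (schrodinger V) := by
  by_contra hz
  obtain ⟨R, hR⟩ := (spectrum.notMem_iff.1 hz).exists_left_inv
  have hle : ∀ r : ℝ, 0 < r → r < 1 → 1 ≤ ‖R‖ * (4 * (r⁻¹ - 1)) := fun r h0 h1 => by
    obtain ⟨f, hf, hfle⟩ := hu.exists_approx h0 h1
    have e : R (z • f - schrodinger V f) = f := by
      have := congrArg (fun T : L2 →L[ℂ] L2 => T f) hR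
      simpa [Algebra.algebraMap_eq_smul_one] using this
    have hpos : 0 < ‖f‖ := norm_pos_iff.2 hf
    have h := R.le_opNorm (z • f - schrodinger V f)
    rw [e, norm_sub_rev] at h
    have h2 := h.trans (mul_le_mul_of_nonneg_left hfle (norm_nonneg R))
    by_contra hlt
    push Not at hlt
    nlinarith
  have hR0 := norm_nonneg R
  have hd : 0 < 8 * ‖R‖ + 1 := by positivity
  -- For this r, `r⁻¹ - 1` equals 1 / (8‖R‖ + 1), so the bound is 4‖R‖ / (8‖R‖ + 1) < 1.
  have h := hle ((8 * ‖R‖ + 1) / (8 * ‖R‖ + 2)) (by positivity)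
    ((div_lt_one (by positivity)).2 (by linarith))
  rw [inv_div, div_sub_one hd.ne'] at h
  have h3 : ‖R‖ * (4 * ((8 * ‖R‖ + 2 - (8 * ‖R‖ + 1)) / (8 * ‖R‖ + 1))) =
      4 * ‖R‖ / (8 * ‖R‖ + 1) := by ring
  rw [h3, le_div_iff₀ hd] at h
  linarith

/-- The substitution `u(n) ↦ (-1)^(n₁ + n₂) u(n)`. -/
theorem IsBoundedEigenfunction.neg {V : ℤ × ℤ → ℝ} {z : ℂ} {u : ℤ × ℤ → ℂ}
    (hu : IsBoundedEigenfunction V z u) :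
    ∃ w, IsBoundedEigenfunction (fun n => -V n) (-z) w := by
  obtain ⟨C, hC⟩ := hu.bounded
  obtain ⟨n₀, hn₀⟩ := hu.ne_zero
  -- The alternating sign is not periodic when p or q is odd; only boundedness is needed on ℤ².
  refine ⟨fun n => (-1 : ℂ) ^ (n.1 + n.2) * u n, ⟨C, fun n => ?_⟩, ⟨n₀, ?_⟩, fun n => ?_⟩
  · simpa using hC n
  · simp [hn₀, zpow_ne_zero]
  · have h := hu.eigen n
    have e₁ : (-1 : ℂ) ^ (n.1 - 1 + n.2) = -(-1) ^ (n.1 + n.2) := by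
      rw [show n.1 - 1 + n.2 = n.1 + n.2 - 1 by ring, zpow_sub_one₀ (by norm_num)]; norm_num
    have e₂ : (-1 : ℂ) ^ (n.1 + 1 + n.2) = -(-1) ^ (n.1 + n.2) := by
      rw [show n.1 + 1 + n.2 = n.1 + n.2 + 1 by ring, zpow_add_one₀ (by norm_num)]; norm_num
    have e₃ : (-1 : ℂ) ^ (n.1 + (n.2 - 1)) = -(-1) ^ (n.1 + n.2) := by
      rw [show n.1 + (n.2 - 1) = n.1 + n.2 - 1 by ring, zpow_sub_one₀ (by norm_num)]; norm_num
    have e₄ : (-1 : ℂ) ^ (n.1 + (n.2 + 1)) = -(-1) ^ (n.1 + n.2) := by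
      rw [show n.1 + (n.2 + 1) = n.1 + n.2 + 1 by ring, zpow_add_one₀ (by norm_num)]; norm_num
    simp only [Prod.fst_sub, Prod.snd_sub, Prod.fst_add, Prod.snd_add, sub_zero, add_zero, e₁, e₂,
      e₃, e₄, Complex.ofReal_neg]
    linear_combination -(-1 : ℂ) ^ (n.1 + n.2) * h

/-! ### Level curves of the free energy -/

open Polynomial in
/-- The translate of the level curve `cos x + cos y = c` by a pair of angles with distinct cosines
`A`, `B` meets the curve in at most finitely many values of `cos x`. -/
theorem finite_cos_shift (c : ℝ) {α β : ℝ} (hαβ : Real.cos α ≠ Real.cos β) :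
    {X : ℝ | ∃ x y : ℝ, X = Real.cos x ∧ Real.cos x + Real.cos y = c ∧
      Real.cos (x + α) + Real.cos (y + β) = c}.Finite := by
  set A := Real.cos α
  set B := Real.cos β
  -- With X = cos x and cos y = c - X, the shifted equation reads E = S + T, where S = sin x sin α
  -- and T = sin y sin β. Squaring twice gives (E² - S² - T²)² = 4S²T², a polynomial equation in X.
  let P : ℝ[X] := (((C A * X + C B * (C c - X) - C c) ^ 2 - (1 - X ^ 2) * C (1 - A ^ 2)
      - (1 - (C c - X) ^ 2) * C (1 - B ^ 2)) ^ 2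
      - C 4 * (1 - X ^ 2) * (1 - (C c - X) ^ 2) * C (1 - A ^ 2) * C (1 - B ^ 2))
  have hP : P ≠ 0 := fun h => by
    have ev : ∀ t : ℝ, P.eval t = 0 := fun t => by rw [h, eval_zero]
    have e₀ := ev 0
    have e₁ := ev 1
    have e₂ := ev (-1)
    have e₃ := ev 2
    have e₄ := ev (-2)
    simp only [P, eval_sub, eval_add, eval_mul, eval_pow, eval_C, eval_X, eval_one]
      at e₀ e₁ e₂ e₃ e₄
    -- The fourth difference isolates the X⁴ coefficient 4(A - B)², times 4! = 24.
    have hsq : (A - B) ^ 2 = 0 := by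
      linear_combination (e₃ - 4 * e₁ + 6 * e₀ - 4 * e₂ + e₄) / 96
    exact hαβ (sub_eq_zero.1 (pow_eq_zero_iff two_ne_zero |>.1 hsq))
  refine (P.roots.toFinset.finite_toSet).subset ?_
  rintro _ ⟨x, y, rfl, h₁, h₂⟩
  simp only [Finset.mem_coe, Multiset.mem_toFinset, mem_roots hP, IsRoot.def]
  rw [Real.cos_add, Real.cos_add] at h₂
  have hy : c - Real.cos x = Real.cos y := by linarith
  have s₁ := Real.sin_sq_add_cos_sq x
  have s₂ := Real.sin_sq_add_cos_sq y
  have s₃ : Real.sin α ^ 2 + A ^ 2 = 1 := Real.sin_sq_add_cos_sq α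
  have s₄ : Real.sin β ^ 2 + B ^ 2 = 1 := Real.sin_sq_add_cos_sq β
  have r₁ : 1 - Real.cos x ^ 2 = Real.sin x ^ 2 := by linarith
  have r₂ : 1 - Real.cos y ^ 2 = Real.sin y ^ 2 := by linarith
  have r₃ : 1 - A ^ 2 = Real.sin α ^ 2 := by linarith
  have r₄ : 1 - B ^ 2 = Real.sin β ^ 2 := by linarith
  have e : A * Real.cos x + B * Real.cos y - c =
      Real.sin x * Real.sin α + Real.sin y * Real.sin β := by linear_combination h₂
  simp only [P, eval_sub, eval_add, eval_mul, eval_pow, eval_C, eval_X, eval_one, hy, r₁, r₂, r₃,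
    r₄, e]
  ring

/-- Equal cosines mean s₁/p ≡ ± s₂/q modulo 1. After clearing denominators, coprimality forces p ∣
s₁ and q ∣ s₂, hence s = 0. -/
theorem cos_ne_cos_of_coprime {p q : ℕ} [NeZero p] [NeZero q] (hpq : Nat.Coprime p q)
    {s : ZMod p × ZMod q} (hs : s ≠ 0) :
    Real.cos (2 * Real.pi * s.1.val / p) ≠ Real.cos (2 * Real.pi * s.2.val / q) := by
  intro h
  have hp : (p : ℝ) ≠ 0 := Nat.cast_ne_zero.2 (NeZero.ne p)
  have hq : (q : ℝ) ≠ 0 := Nat.cast_ne_zero.2 (NeZero.ne q)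
  have hpi := Real.pi_ne_zero
  have key : ∃ k e : ℤ, (e = 1 ∨ e = -1) ∧
      (s.2.val : ℤ) * p = k * p * q + e * (s.1.val * q) := by
    obtain ⟨k, hk | hk⟩ := Real.cos_eq_cos_iff.1 h
    · refine ⟨k, 1, Or.inl rfl, ?_⟩
      field_simp at hk
      have : ((s.2.val : ℤ) * p : ℝ) = k * p * q + (1 : ℤ) * (s.1.val * q) := by
        push_cast; linear_combination hk
      exact_mod_cast this
    · refine ⟨k, -1, Or.inr rfl, ?_⟩
      field_simp at hk
      have : ((s.2.val : ℤ) * p : ℝ) = k * p * q + (-1 : ℤ) * (s.1.val * q) := by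
        push_cast; linear_combination hk
      exact_mod_cast this
  obtain ⟨k, e, he, hk⟩ := key
  have d₂ : q ∣ s.2.val := by
    refine Nat.Coprime.dvd_of_dvd_mul_right hpq.symm (n := p) ?_
    rw [← Int.natCast_dvd_natCast]
    push_cast
    exact ⟨k * p + e * s.1.val, by linear_combination hk⟩
  have d₁ : p ∣ s.1.val := by
    refine Nat.Coprime.dvd_of_dvd_mul_right hpq (n := q) ?_
    rw [← Int.natCast_dvd_natCast]
    push_cast
    rcases he with rfl | rfl
    · exact ⟨s.2.val - k * q, by linear_combination -hk⟩
    · exact ⟨k * q - s.2.val, by linear_combination hk⟩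
  have z₁ := Nat.eq_zero_of_dvd_of_lt d₁ (ZMod.val_lt _)
  have z₂ := Nat.eq_zero_of_dvd_of_lt d₂ (ZMod.val_lt _)
  exact hs (Prod.ext ((ZMod.val_eq_zero _).1 z₁) ((ZMod.val_eq_zero _).1 z₂))

/-- The eigenvalue of the free Laplacian on the plane wave with quasimomentum `k + 2π (s₁/p, s₂/q)`. -/
def freeEnergy (p q : ℕ) (k : ℝ × ℝ) (s : ZMod p × ZMod q) : ℝ :=
  2 * Real.cos (k.1 + 2 * Real.pi * s.1.val / p) + 2 * Real.cos (k.2 + 2 * Real.pi * s.2.val / q)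

/-- Inside the free spectrum, some point of the level curve `2 cos x + 2 cos y = μ` lies on none of
its nontrivial translates. -/
theorem exists_simple_point {p q : ℕ} [NeZero p] [NeZero q] (hpq : Nat.Coprime p q) {μ : ℝ}
    (h₁ : -4 < μ) (h₂ : μ < 4) :
    ∃ x, ∃ y ∈ Set.Ioo 0 Real.pi, 2 * Real.cos x + 2 * Real.cos y = μ ∧
      ∀ s : ZMod p × ZMod q, s ≠ 0 → freeEnergy p q (x, y) s - μ ≠ 0 := by
  have hfin := Set.finite_iUnion fun s : {s : ZMod p × ZMod q // s ≠ 0} =>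
    finite_cos_shift (μ / 2) (cos_ne_cos_of_coprime hpq s.2)
  -- These are the X for which both X and μ/2 - X lie in (-1, 1); the interval is nonempty because
  -- |μ| < 4.
  have hinf : (Set.Ioo (max (-1) (μ / 2 - 1)) (min 1 (μ / 2 + 1))).Infinite := by
    refine Set.Ioo_infinite (max_lt (lt_min ?_ ?_) (lt_min ?_ ?_)) <;> linarith
  obtain ⟨X, hX, hX'⟩ := (hinf.sdiff hfin).nonempty
  simp only [Set.mem_Ioo, max_lt_iff, lt_min_iff] at hX
  obtain ⟨⟨a₁, a₂⟩, a₃, a₄⟩ := hX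
  have cx : Real.cos (Real.arccos X) = X := Real.cos_arccos a₁.le a₃.le
  have cy : Real.cos (Real.arccos (μ / 2 - X)) = μ / 2 - X :=
    Real.cos_arccos (by linarith) (by linarith)
  refine ⟨Real.arccos X, Real.arccos (μ / 2 - X), ⟨Real.arccos_pos.2 (by linarith), ?_⟩,
    by rw [cx, cy]; ring, fun s hs h0 => hX' (Set.mem_iUnion.2
    ⟨⟨s, hs⟩, Real.arccos X, Real.arccos (μ / 2 - X), cx.symm,
      by rw [cx, cy]; ring, ?_⟩)⟩
  · refine lt_of_le_of_ne (Real.arccos_le_pi _) fun h => ?_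
    rw [Real.arccos_eq_pi] at h
    linarith
  · simp only [freeEnergy] at h0
    linarith

/-- At a simple point only the factor s = 0 vanishes. Cosine is strictly monotone on (0, π), so
moving the second coordinate through the point flips the sign of that factor alone. -/
theorem exists_prod_freeEnergy_neg_pos {p q : ℕ} [NeZero p] [NeZero q] (hpq : Nat.Coprime p q)
    {μ : ℝ} (h₁ : -4 < μ) (h₂ : μ < 4) :
    ∃ k k' : ℝ × ℝ, ∏ s, (freeEnergy p q k s - μ) < 0 ∧ 0 < ∏ s, (freeEnergy p q k' s - μ) := by
  obtain ⟨x, y, hy, hxy, hne⟩ := exists_simple_point hpq h₁ h₂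
  let Q : ℝ → ℝ := fun t => ∏ s ∈ Finset.univ.erase (0 : ZMod p × ZMod q),
    (freeEnergy p q (x, t) s - μ)
  have hQ : ∀ t, ∏ s, (freeEnergy p q (x, t) s - μ) = 2 * (Real.cos t - Real.cos y) * Q t :=
    fun t => by
      rw [← Finset.mul_prod_erase _ _ (Finset.mem_univ (0 : ZMod p × ZMod q))]
      congr 1
      simp only [freeEnergy, Prod.fst_zero, Prod.snd_zero, ZMod.val_zero]
      simp only [Nat.cast_zero, mul_zero, zero_div, add_zero]
      linarith
  have hQc : Continuous Q := by
    refine continuous_finsetProd _ fun s _ => ?_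
    unfold freeEnergy
    fun_prop
  have hQy : Q y ≠ 0 := Finset.prod_ne_zero_iff.2 fun s hs => hne s (Finset.ne_of_mem_erase hs)
  have hev : ∀ᶠ t in nhds y, 0 < Q t * Q y ∧ t ∈ Set.Ioo 0 Real.pi :=
    ((hQc.mul continuous_const).continuousAt.eventually
      (lt_mem_nhds (mul_self_pos.2 hQy))).and (Ioo_mem_nhds hy.1 hy.2)
  obtain ⟨t₁, ht₁, hQ₁, hI₁⟩ := (hev.filter_mono nhdsWithin_le_nhds |>.and
    (self_mem_nhdsWithin (s := Set.Iio y))).exists.imp fun t h => (⟨h.2, h.1⟩ : t < y ∧ _)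
  obtain ⟨t₂, ht₂, hQ₂, hI₂⟩ := (hev.filter_mono nhdsWithin_le_nhds |>.and
    (self_mem_nhdsWithin (s := Set.Ioi y))).exists.imp fun t h => (⟨h.2, h.1⟩ : y < t ∧ _)
  have c₁ : 0 < Real.cos t₁ - Real.cos y :=
    sub_pos.2 (Real.strictAntiOn_cos ⟨hI₁.1.le, hI₁.2.le⟩ ⟨hy.1.le, hy.2.le⟩ ht₁)
  have c₂ : Real.cos t₂ - Real.cos y < 0 :=
    sub_neg.2 (Real.strictAntiOn_cos ⟨hy.1.le, hy.2.le⟩ ⟨hI₂.1.le, hI₂.2.le⟩ ht₂)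
  rcases lt_or_gt_of_ne hQy with hneg | hpos
  · have q₁ : Q t₁ < 0 := by nlinarith
    have q₂ : Q t₂ < 0 := by nlinarith
    refine ⟨(x, t₁), (x, t₂), ?_, ?_⟩ <;> rw [hQ] <;> nlinarith
  · have q₁ : 0 < Q t₁ := by nlinarith
    have q₂ : 0 < Q t₂ := by nlinarith
    refine ⟨(x, t₂), (x, t₁), ?_, ?_⟩ <;> rw [hQ] <;> nlinarith

/-- The value 4 would need (2s₁ + 1)π/p to be a multiple of 2π, making an odd integer even. -/
theorem freeEnergy_pi_div_lt {p q : ℕ} [NeZero p] (s : ZMod p × ZMod q) :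
    freeEnergy p q (Real.pi / p, 0) s < 4 := by
  have hp : (p : ℝ) ≠ 0 := Nat.cast_ne_zero.2 (NeZero.ne p)
  have h₁ : Real.cos (Real.pi / p + 2 * Real.pi * s.1.val / p) < 1 := by
    refine lt_of_le_of_ne (Real.cos_le_one _) fun h => ?_
    obtain ⟨m, hm⟩ := (Real.cos_eq_one_iff _).1 h
    have hpi := Real.pi_ne_zero
    field_simp at hm
    have : m * 2 * p = 1 + 2 * (s.1.val : ℤ) := by
      have : (m * 2 * p : ℝ) = 1 + 2 * (s.1.val : ℤ) := by push_cast; linear_combination hm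
      exact_mod_cast this
    have h2 : m * 2 * p = 2 * (m * p) := by ring
    omega
  have h₂ := Real.cos_le_one (0 + 2 * Real.pi * s.2.val / q)
  simp only [freeEnergy]
  linarith

/-! ### Bloch matrices and their diagonalisation at zero potential -/

/-- The Bloch Hamiltonian with quasimomentum `k` of the `(p, q)`-periodic potential given by `v`:
`Δ + v` acting on functions `n ↦ exp (i k·n) w(n)` with `w` periodic. -/
def blochMatrix {p q : ℕ} (k : ℝ × ℝ) (v : ZMod p × ZMod q → ℝ) :
    Matrix (ZMod p × ZMod q) (ZMod p × ZMod q) ℂ := Matrix.of fun i j =>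
  (((if j = i - (1, 0) then Complex.exp (-(k.1 * Complex.I)) else 0) +
    (if j = i + (1, 0) then Complex.exp (k.1 * Complex.I) else 0)) +
   ((if j = i - (0, 1) then Complex.exp (-(k.2 * Complex.I)) else 0) +
    (if j = i + (0, 1) then Complex.exp (k.2 * Complex.I) else 0))) +
  (if j = i then (v i : ℂ) else 0)

theorem continuous_blochMatrix {p q : ℕ} :
    Continuous fun x : (ℝ × ℝ) × (ZMod p × ZMod q → ℝ) => blochMatrix x.1 x.2 := by
  refine continuous_matrix fun i j => ?_
  simp only [blochMatrix, Matrix.of_apply]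
  split_ifs <;> fun_prop

theorem isHermitian_blochMatrix {p q : ℕ} (k : ℝ × ℝ) (v : ZMod p × ZMod q → ℝ) :
    (blochMatrix k v).IsHermitian := by
  have conj_exp : ∀ t : ℝ, star (Complex.exp (t * Complex.I)) = Complex.exp (-(t * Complex.I)) :=
    fun t => by
      rw [Complex.star_def, ← Complex.exp_conj, map_mul, Complex.conj_ofReal, Complex.conj_I,
        mul_neg]
  have conj_exp' : ∀ t : ℝ,
      star (Complex.exp (-(t * Complex.I))) = Complex.exp (t * Complex.I) := fun t => by
    rw [← conj_exp, star_star]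
  have hsw : ∀ i j b : ZMod p × ZMod q, (j = i + b) = (i = j - b) := fun i j b => by
    rw [eq_iff_iff, eq_sub_iff_add_eq, eq_comm]
  have hsw' : ∀ i j b : ZMod p × ZMod q, (j = i - b) = (i = j + b) := fun i j b => by
    rw [hsw]
  ext i j
  simp only [blochMatrix, Matrix.conjTranspose_apply, Matrix.of_apply, star_add,
    apply_ite (star : ℂ → ℂ), star_zero, conj_exp, conj_exp', hsw' j i, hsw j i]
  have hd : (if i = j then star ((v j : ℝ) : ℂ) else 0) = if j = i then ((v i : ℝ) : ℂ) else 0 := by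
    by_cases h : i = j
    · subst h; simp
    · rw [if_neg h, if_neg (Ne.symm h)]
  rw [hd]
  ring

section

variable {p q : ℕ} [NeZero p] [NeZero q]

theorem blochMatrix_mulVec (k : ℝ × ℝ) (v : ZMod p × ZMod q → ℝ) (w : ZMod p × ZMod q → ℂ)
    (i : ZMod p × ZMod q) :
    (blochMatrix k v).mulVec w i =
      ((Complex.exp (-(k.1 * Complex.I)) * w (i - (1, 0)) +
        Complex.exp (k.1 * Complex.I) * w (i + (1, 0))) +
       (Complex.exp (-(k.2 * Complex.I)) * w (i - (0, 1)) +
        Complex.exp (k.2 * Complex.I) * w (i + (0, 1)))) + v i * w i := by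
  simp only [Matrix.mulVec, dotProduct, blochMatrix, Matrix.of_apply, add_mul, ite_mul, zero_mul,
    Finset.sum_add_distrib, Finset.sum_ite_eq', Finset.mem_univ, if_true]

/-- The characters of `ℤ/p × ℤ/q`. -/
def planeWave (p q : ℕ) [NeZero p] [NeZero q] : Matrix (ZMod p × ZMod q) (ZMod p × ZMod q) ℂ :=
  Matrix.of fun n s => ZMod.stdAddChar (n.1 * s.1) * ZMod.stdAddChar (n.2 * s.2)

/-- Orthogonality of characters: the conjugate matrix is an inverse up to the factor pq. -/
theorem det_planeWave_ne_zero : (planeWave p q).det ≠ 0 := by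
  let W : Matrix (ZMod p × ZMod q) (ZMod p × ZMod q) ℂ :=
    Matrix.of fun n s => ZMod.stdAddChar (-(n.1 * s.1)) * ZMod.stdAddChar (-(n.2 * s.2))
  have h : W * planeWave p q = ((p : ℂ) * q) • 1 := by
    ext m s
    have e : ∀ n : ZMod p × ZMod q, W m n * planeWave p q n s =
        ZMod.stdAddChar (n.1 * (s.1 - m.1)) * ZMod.stdAddChar (n.2 * (s.2 - m.2)) := fun n => by
      simp only [W, planeWave, Matrix.of_apply]
      rw [mul_mul_mul_comm, ← AddChar.map_add_eq_mul, ← AddChar.map_add_eq_mul]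
      congr 2 <;> ring
    rw [Matrix.mul_apply, Finset.sum_congr rfl fun n _ => e n, Fintype.sum_prod_type]
    simp only [← Finset.mul_sum, ← Finset.sum_mul,
      AddChar.sum_mulShift _ (ZMod.isPrimitive_stdAddChar _), ZMod.card, Matrix.smul_apply,
      Matrix.one_apply, Prod.ext_iff, sub_eq_zero]
    by_cases h₁ : s.1 = m.1 <;> by_cases h₂ : s.2 = m.2 <;>
      simp [h₁, h₂, eq_comm (a := m.1), eq_comm (a := m.2)]
  intro h0
  have hd := congrArg Matrix.det h
  rw [Matrix.det_mul, h0, mul_zero, Matrix.det_smul, Matrix.det_one, mul_one] at hd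
  have hp : (p : ℂ) ≠ 0 := Nat.cast_ne_zero.2 (NeZero.ne p)
  have hq : (q : ℂ) ≠ 0 := Nat.cast_ne_zero.2 (NeZero.ne q)
  exact pow_ne_zero _ (mul_ne_zero hp hq) hd.symm

theorem exp_mul_stdAddChar (t : ℝ) (a : ZMod p) :
    Complex.exp (-(t * Complex.I)) * ZMod.stdAddChar (-a) +
      Complex.exp (t * Complex.I) * ZMod.stdAddChar a =
      ((2 * Real.cos (t + 2 * Real.pi * a.val / p) : ℝ) : ℂ) := by
  have h : ZMod.stdAddChar a = Complex.exp (2 * Real.pi * Complex.I * (a.val : ℤ) / p) := by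
    rw [← ZMod.stdAddChar_coe]
    simp
  rw [AddChar.map_neg_eq_inv, h, ← Complex.exp_neg, ← Complex.exp_add, ← Complex.exp_add]
  push_cast
  rw [Complex.two_cos]
  rw [add_comm]
  congr 2 <;> ring

theorem blochMatrix_zero_mul_planeWave (k : ℝ × ℝ) :
    blochMatrix k 0 * planeWave p q =
      planeWave p q * Matrix.diagonal fun s => (freeEnergy p q k s : ℂ) := by
  ext n s
  rw [Matrix.mul_diagonal]
  have h := blochMatrix_mulVec k 0 (fun n => planeWave p q n s) n
  rw [Matrix.mul_apply]
  refine h.trans ?_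
  have e₁ := exp_mul_stdAddChar k.1 s.1
  have e₂ := exp_mul_stdAddChar k.2 s.2
  simp only [planeWave, Matrix.of_apply, Prod.fst_add, Prod.snd_add, Prod.fst_neg,
    Prod.snd_neg, neg_zero, neg_mul, add_zero, add_mul, one_mul, sub_eq_add_neg,
    AddChar.map_add_eq_mul, freeEnergy, Pi.zero_apply, Complex.ofReal_zero, zero_mul]
  rw [Complex.ofReal_add, ← e₁, ← e₂]
  ring

theorem det_blochMatrix_zero_sub (k : ℝ × ℝ) (μ : ℝ) :
    (blochMatrix (p := p) (q := q) k 0 - (μ : ℂ) • 1).det =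
      ((∏ s, (freeEnergy p q k s - μ) : ℝ) : ℂ) := by
  have h : (blochMatrix k 0 - (μ : ℂ) • 1) * planeWave p q =
      planeWave p q * Matrix.diagonal fun s => ((freeEnergy p q k s - μ : ℝ) : ℂ) := by
    rw [sub_mul, blochMatrix_zero_mul_planeWave, Matrix.smul_mul, Matrix.one_mul]
    have : (Matrix.diagonal fun s => ((freeEnergy p q k s - μ : ℝ) : ℂ)) =
        (Matrix.diagonal fun s => (freeEnergy p q k s : ℂ)) - (μ : ℂ) • 1 := by
      rw [Matrix.smul_one_eq_diagonal, Matrix.diagonal_sub]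
      simp
    rw [this, mul_sub, Matrix.mul_smul, Matrix.mul_one]
  have hd := congrArg Matrix.det h
  rw [Matrix.det_mul, Matrix.det_mul, Matrix.det_diagonal, mul_comm] at hd
  rw [mul_left_cancel₀ det_planeWave_ne_zero hd]
  push_cast
  rfl

theorem det_blochMatrix_sub_im (k : ℝ × ℝ) (v : ZMod p × ZMod q → ℝ) (μ : ℝ) :
    ((blochMatrix k v - (μ : ℂ) • 1).det).im = 0 := by
  have h : (blochMatrix k v - (μ : ℂ) • 1).IsHermitian := by
    refine (isHermitian_blochMatrix k v).sub ?_
    rw [Matrix.IsHermitian, Matrix.conjTranspose_smul, Matrix.conjTranspose_one, Complex.star_def,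
      Complex.conj_ofReal]
  have hd := congrArg Matrix.det h
  rw [Matrix.det_conjTranspose] at hd
  exact Complex.conj_eq_iff_im.1 hd

/-- An eigenvector of a Bloch Hamiltonian gives a bounded solution on `ℤ²`. -/
theorem exists_isBoundedEigenfunction {k : ℝ × ℝ} {v : ZMod p × ZMod q → ℝ} {z : ℂ}
    {w : ZMod p × ZMod q → ℂ} (hw : w ≠ 0) (h : (blochMatrix k v).mulVec w = z • w) :
    ∃ u, IsBoundedEigenfunction (fun n : ℤ × ℤ => v (n.1, n.2)) z u := by
  obtain ⟨i, hi⟩ := Function.ne_iff.1 hw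
  have hnorm : ∀ n : ℤ × ℤ, ‖Complex.exp ((k.1 * n.1 + k.2 * n.2) * Complex.I)‖ = 1 := fun n => by
    exact_mod_cast Complex.norm_exp_ofReal_mul_I (k.1 * n.1 + k.2 * n.2)
  refine ⟨fun n => Complex.exp ((k.1 * n.1 + k.2 * n.2) * Complex.I) * w (n.1, n.2),
    ⟨∑ j, ‖w j‖, fun n => ?_⟩, ⟨(i.1.val, i.2.val), ?_⟩, fun n => ?_⟩
  · rw [norm_mul, hnorm, one_mul]
    exact Finset.single_le_sum (f := fun j => ‖w j‖) (fun _ _ => norm_nonneg _)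
      (Finset.mem_univ _)
  · refine mul_ne_zero (Complex.exp_ne_zero _) ?_
    simpa using hi
  · have h' := congrFun h (n.1, n.2)
    rw [blochMatrix_mulVec] at h'
    simp only [Pi.smul_apply, smul_eq_mul, Prod.mk_sub_mk, Prod.mk_add_mk, sub_zero, add_zero]
      at h'
    simp only [Prod.fst_sub, Prod.snd_sub, Prod.fst_add, Prod.snd_add, sub_zero, add_zero,
      Int.cast_sub, Int.cast_add, Int.cast_one]
    have e₁ : Complex.exp ((k.1 * (n.1 - 1) + k.2 * n.2) * Complex.I) =
        Complex.exp ((k.1 * n.1 + k.2 * n.2) * Complex.I) * Complex.exp (-(k.1 * Complex.I)) := by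
      rw [← Complex.exp_add]; congr 1; ring
    have e₂ : Complex.exp ((k.1 * (n.1 + 1) + k.2 * n.2) * Complex.I) =
        Complex.exp ((k.1 * n.1 + k.2 * n.2) * Complex.I) * Complex.exp (k.1 * Complex.I) := by
      rw [← Complex.exp_add]; congr 1; ring
    have e₃ : Complex.exp ((k.1 * n.1 + k.2 * (n.2 - 1)) * Complex.I) =
        Complex.exp ((k.1 * n.1 + k.2 * n.2) * Complex.I) * Complex.exp (-(k.2 * Complex.I)) := by
      rw [← Complex.exp_add]; congr 1; ring
    have e₄ : Complex.exp ((k.1 * n.1 + k.2 * (n.2 + 1)) * Complex.I) =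
        Complex.exp ((k.1 * n.1 + k.2 * n.2) * Complex.I) * Complex.exp (k.2 * Complex.I) := by
      rw [← Complex.exp_add]; congr 1; ring
    rw [e₁, e₂, e₃, e₄]
    linear_combination Complex.exp ((k.1 * n.1 + k.2 * n.2) * Complex.I) * h'

end

/-! ### The top eigenvalue of a Hermitian matrix -/

/-- The largest value of the quadratic form of `A` on the unit sphere. -/
def topEnergy {ι : Type*} [Fintype ι] [DecidableEq ι] (A : Matrix ι ι ℂ) : ℝ :=
  sSup ((fun w => (Matrix.toEuclideanCLM (𝕜 := ℂ) A).reApplyInnerSelf w) ''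
    Metric.sphere (0 : EuclideanSpace ℂ ι) 1)

section

variable {ι : Type*} [Fintype ι] [DecidableEq ι]

theorem continuous_topEnergy {X : Type*} [TopologicalSpace X] {A : X → Matrix ι ι ℂ}
    (hA : Continuous A) : Continuous fun x => topEnergy (A x) := by
  refine IsCompact.continuous_sSup (isCompact_sphere _ _)
    (f := fun x (w : EuclideanSpace ℂ ι) =>
      (Matrix.toEuclideanCLM (𝕜 := ℂ) (A x)).reApplyInnerSelf w) ?_
  have h : Continuous fun y : X × EuclideanSpace ℂ ι =>
      (WithLp.toLp 2 ((A y.1).mulVec (WithLp.ofLp y.2)) : EuclideanSpace ℂ ι) :=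
    (PiLp.continuous_toLp 2 _).comp
      ((hA.comp continuous_fst).matrix_mulVec ((PiLp.continuous_ofLp 2 _).comp continuous_snd))
  exact Complex.continuous_re.comp (h.inner continuous_snd)

theorem reApplyInnerSelf_le_topEnergy (A : Matrix ι ι ℂ) (w : EuclideanSpace ℂ ι) :
    (Matrix.toEuclideanCLM (𝕜 := ℂ) A).reApplyInnerSelf w ≤ topEnergy A * ‖w‖ ^ 2 := by
  by_cases hw : w = 0
  · simp [hw, ContinuousLinearMap.reApplyInnerSelf]
  have hpos : 0 < ‖w‖ := norm_pos_iff.2 hw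
  have h : (Matrix.toEuclideanCLM (𝕜 := ℂ) A).reApplyInnerSelf ((‖w‖⁻¹ : ℂ) • w) ≤
      topEnergy A := by
    refine le_csSup ((isCompact_sphere _ _).image
      (ContinuousLinearMap.reApplyInnerSelf_continuous _)).bddAbove ⟨_, ?_, rfl⟩
    simp [norm_smul, hpos.ne']
  rw [ContinuousLinearMap.reApplyInnerSelf_smul, norm_inv, Complex.norm_real, norm_norm,
    inv_pow, inv_mul_le_iff₀ (by positivity)] at h
  linarith

/-- By compactness the form attains its maximum on the sphere. A maximiser for a self-adjoint
operator is an eigenvector, and evaluating the form there identifies its eigenvalue. -/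
theorem exists_mulVec_eq_topEnergy [Nonempty ι] {A : Matrix ι ι ℂ} (hA : A.IsHermitian) :
    ∃ w : ι → ℂ, w ≠ 0 ∧ A.mulVec w = (topEnergy A : ℂ) • w := by
  obtain ⟨w, hw, hmax⟩ := (isCompact_sphere (0 : EuclideanSpace ℂ ι) 1).exists_sSup_image_eq
    (NormedSpace.sphere_nonempty.2 zero_le_one)
    (ContinuousLinearMap.reApplyInnerSelf_continuous
      (Matrix.toEuclideanCLM (𝕜 := ℂ) A)).continuousOn
  have hw1 : ‖w‖ = 1 := by simpa using hw
  have hw0 : w ≠ 0 := fun h => by simp [h] at hw1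
  have hsa : IsSelfAdjoint (Matrix.toEuclideanCLM (𝕜 := ℂ) A) := by
    rw [IsSelfAdjoint, ← map_star]
    exact congrArg _ hA
  have hext : IsMaxOn (Matrix.toEuclideanCLM (𝕜 := ℂ) A).reApplyInnerSelf
      (Metric.sphere 0 ‖w‖) w := by
    intro x hx
    rw [hw1] at hx
    change _ ≤ (Matrix.toEuclideanCLM (𝕜 := ℂ) A).reApplyInnerSelf w
    rw [← hmax]
    exact le_csSup ((isCompact_sphere _ _).image
      (ContinuousLinearMap.reApplyInnerSelf_continuous _)).bddAbove ⟨x, hx, rfl⟩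
  have hv := (hsa.hasEigenvector_of_isMaxOn hw0 hext).apply_eq_smul
  set μ : ℝ := ⨆ x : {x : EuclideanSpace ℂ ι // x ≠ 0},
    (Matrix.toEuclideanCLM (𝕜 := ℂ) A).rayleighQuotient ↑x
  have hv' : Matrix.toEuclideanCLM (𝕜 := ℂ) A w = (μ : ℂ) • w := hv
  have hμ : topEnergy A = μ := by
    rw [topEnergy, hmax, ContinuousLinearMap.reApplyInnerSelf, hv', inner_smul_left,
      inner_self_eq_norm_sq_to_K, hw1]
    simp
  refine ⟨WithLp.ofLp w, fun h => hw0 (WithLp.ofLp_injective 2 h), ?_⟩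
  rw [← Matrix.ofLp_toEuclideanCLM, hv', hμ, WithLp.ofLp_smul]

end

/-! ### Bloch energies by the intermediate value theorem -/

section

variable {p q : ℕ} [NeZero p] [NeZero q]

theorem topEnergy_blochMatrix_zero_lt :
    topEnergy (blochMatrix (p := p) (q := q) (Real.pi / p, 0) 0) < 4 := by
  obtain ⟨w, hw, h⟩ := exists_mulVec_eq_topEnergy
    (isHermitian_blochMatrix (p := p) (q := q) (Real.pi / p, 0) 0)
  set μ := topEnergy (blochMatrix (p := p) (q := q) (Real.pi / p, 0) 0)
  have hd : (blochMatrix (p := p) (q := q) (Real.pi / p, 0) 0 - (μ : ℂ) • 1).det = 0 := by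
    refine Matrix.exists_mulVec_eq_zero_iff.1 ⟨w, hw, ?_⟩
    rw [Matrix.sub_mulVec, Matrix.smul_mulVec, Matrix.one_mulVec, h, sub_self]
  rw [det_blochMatrix_zero_sub, Complex.ofReal_eq_zero, Finset.prod_eq_zero_iff] at hd
  obtain ⟨s, -, hs⟩ := hd
  have := freeEnergy_pi_div_lt (p := p) (q := q) s
  linarith

/-- The characteristic polynomial of a Bloch Hamiltonian, which is real at real energies. -/
def blochDet (k : ℝ × ℝ) (v : ZMod p × ZMod q → ℝ) (μ : ℝ) : ℝ :=
  ((blochMatrix k v - (μ : ℂ) • 1).det).re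

theorem continuous_blochDet :
    Continuous fun y : (ℝ × ℝ) × ((ZMod p × ZMod q → ℝ) × ℝ) => blochDet y.1 y.2.1 y.2.2 := by
  have h₁ : Continuous fun y : (ℝ × ℝ) × ((ZMod p × ZMod q → ℝ) × ℝ) => blochMatrix y.1 y.2.1 :=
    continuous_blochMatrix.comp
      (f := fun y : (ℝ × ℝ) × ((ZMod p × ZMod q → ℝ) × ℝ) => (y.1, y.2.1)) (by fun_prop)
  have h₂ : Continuous fun y : (ℝ × ℝ) × ((ZMod p × ZMod q → ℝ) × ℝ) =>
      (y.2.2 : ℂ) • (1 : Matrix (ZMod p × ZMod q) (ZMod p × ZMod q) ℂ) :=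
    (Complex.continuous_ofReal.comp (continuous_snd.comp continuous_snd)).smul continuous_const
  exact Complex.continuous_re.comp (h₁.sub h₂).matrix_det

theorem blochDet_zero (k : ℝ × ℝ) (μ : ℝ) :
    blochDet k (0 : ZMod p × ZMod q → ℝ) μ = ∏ s, (freeEnergy p q k s - μ) := by
  rw [blochDet, det_blochMatrix_zero_sub, Complex.ofReal_re]

theorem exists_isBoundedEigenfunction_of_blochDet {k : ℝ × ℝ} {v : ZMod p × ZMod q → ℝ} {μ : ℝ}
    (h : blochDet k v μ = 0) :
    ∃ u, IsBoundedEigenfunction (fun n : ℤ × ℤ => v (n.1, n.2)) (μ : ℂ) u := by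
  have hd : (blochMatrix k v - (μ : ℂ) • 1).det = 0 :=
    Complex.ext h (det_blochMatrix_sub_im k v μ)
  obtain ⟨w, hw, hd⟩ := Matrix.exists_mulVec_eq_zero_iff.2 hd
  rw [Matrix.sub_mulVec, Matrix.smul_mulVec, Matrix.one_mulVec, sub_eq_zero] at hd
  exact exists_isBoundedEigenfunction hw hd

/-- For small potentials, every compact part of `(-4, 4)` consists of Bloch energies. -/
theorem eventually_isBoundedEigenfunction (hpq : Nat.Coprime p q) {m : ℝ} (hm : m < 4) :
    ∀ᶠ v : ZMod p × ZMod q → ℝ in nhds 0, ∀ μ ∈ Set.Icc (-m) m,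
      ∃ u, IsBoundedEigenfunction (fun n : ℤ × ℤ => v (n.1, n.2)) (μ : ℂ) u := by
  refine isCompact_Icc.eventually_forall_of_forall_eventually (P := fun (v : ZMod p × ZMod q → ℝ) μ =>
    ∃ u, IsBoundedEigenfunction (fun n : ℤ × ℤ => v (n.1, n.2)) ((μ : ℝ) : ℂ) u) fun μ hμ => ?_
  obtain ⟨k, k', hk, hk'⟩ := exists_prod_freeEnergy_neg_pos hpq (μ := μ) (by linarith [hμ.1])
    (by linarith [hμ.2])
  replace hk : blochDet k (0 : ZMod p × ZMod q → ℝ) μ < 0 := (blochDet_zero k μ).trans_lt hk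
  replace hk' : 0 < blochDet k' (0 : ZMod p × ZMod q → ℝ) μ := hk'.trans_eq (blochDet_zero k' μ).symm
  have c : ∀ k, Continuous fun x : (ZMod p × ZMod q → ℝ) × ℝ => blochDet k x.1 x.2 := fun k =>
    continuous_blochDet.comp (f := fun x : (ZMod p × ZMod q → ℝ) × ℝ => (k, x))
      (Continuous.prodMk_right k)
  -- With k and k' fixed, the two signs persist for all (v, μ') near (0, μ); the zero is then found
  -- by varying the quasimomentum.
  filter_upwards [(c k).continuousAt.eventually (gt_mem_nhds hk),
    (c k').continuousAt.eventually (lt_mem_nhds hk')] with x hx hx'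
  have ck : Continuous fun k => blochDet k x.1 x.2 :=
    continuous_blochDet.comp (f := fun k : ℝ × ℝ => (k, x)) (Continuous.prodMk_left x)
  obtain ⟨l, hl⟩ := mem_range_of_exists_le_of_exists_ge ck ⟨k, hx.le⟩ ⟨k', hx'.le⟩
  exact exists_isBoundedEigenfunction_of_blochDet hl

/-- Every energy between the tops of two Bloch Hamiltonians is a Bloch energy. -/
theorem exists_isBoundedEigenfunction_of_topEnergy {k k' : ℝ × ℝ} {v : ZMod p × ZMod q → ℝ}
    {μ : ℝ} (h : topEnergy (blochMatrix k v) ≤ μ) (h' : μ ≤ topEnergy (blochMatrix k' v)) :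
    ∃ u, IsBoundedEigenfunction (fun n : ℤ × ℤ => v (n.1, n.2)) (μ : ℂ) u := by
  have c : Continuous fun k : ℝ × ℝ => topEnergy (blochMatrix k v) :=
    continuous_topEnergy (continuous_blochMatrix.comp
      (f := fun k : ℝ × ℝ => (k, v)) (Continuous.prodMk_left v))
  obtain ⟨l, hl⟩ := mem_range_of_exists_le_of_exists_ge c ⟨k, h⟩ ⟨k', h'⟩
  obtain ⟨w, hw, hw'⟩ := exists_mulVec_eq_topEnergy (isHermitian_blochMatrix l v)
  rw [show topEnergy (blochMatrix l v) = μ from hl] at hw'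
  exact exists_isBoundedEigenfunction hw hw'

end

/-! ### Bounds for the spectrum from the Bloch matrix at k = 0 -/

theorem inner_translation_left (b : ℤ × ℤ) (x y : L2) :
    inner ℂ (translation b x) y = inner ℂ x (translation (-b) y) := by
  rw [lp.inner_eq_tsum, lp.inner_eq_tsum, ← (Equiv.addRight (-b)).tsum_eq]
  refine tsum_congr fun n => ?_
  simp

theorem isSymmetric_laplacian (x y : L2) :
    inner ℂ (laplacian x) y = inner ℂ x (laplacian y) := by
  simp only [laplacian, add_apply, inner_add_left, inner_add_right,
    inner_translation_left, neg_neg]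
  ring

theorem isSymmetric_multiplication (V : LInf) (x y : L2) :
    inner ℂ (multiplication V x) y = inner ℂ x (multiplication V y) := by
  rw [lp.inner_eq_tsum, lp.inner_eq_tsum]
  refine tsum_congr fun n => ?_
  rw [multiplication_apply, multiplication_apply, ← smul_eq_mul, ← smul_eq_mul, inner_smul_left,
    inner_smul_right, Complex.conj_ofReal]

theorem isSelfAdjoint_schrodinger (V : LInf) : IsSelfAdjoint (schrodinger V) := by
  rw [ContinuousLinearMap.isSelfAdjoint_iff_isSymmetric]
  intro x y
  change inner ℂ (laplacian x + multiplication V x) y = inner ℂ x (laplacian y + multiplication V y)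
  rw [inner_add_left, inner_add_right, isSymmetric_laplacian, isSymmetric_multiplication]

theorem summable_norm_sq (u : L2) : Summable fun n => ‖u n‖ ^ 2 := by
  have h := (lp.memℓp u).summable (by norm_num)
  simpa using h

theorem norm_sq_eq_tsum (u : L2) : ‖u‖ ^ 2 = ∑' n, ‖u n‖ ^ 2 := by
  have h := lp.norm_rpow_eq_tsum (by norm_num) u
  simpa using h

section

variable {G : Type*} [DecidableEq G]

theorem summable_ite_eq {f : ℤ × ℤ → ℝ} (hf : Summable f) (π : ℤ × ℤ → G) (i : G) :
    Summable fun n => if π n = i then f n else 0 := by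
  refine (hf.indicator {n | π n = i}).congr fun n => ?_
  simp [Set.indicator_apply]

theorem sum_tsum_ite_eq [Fintype G] {f : ℤ × ℤ → ℝ} (hf : Summable f) (π : ℤ × ℤ → G) :
    ∑ i, ∑' n, (if π n = i then f n else 0) = ∑' n, f n := by
  rw [← Summable.tsum_finsetSum fun i _ => summable_ite_eq hf π i]
  refine tsum_congr fun n => ?_
  simp

/-- The `ℓ²` norm of the restriction of `u` to a fibre of `π`. -/
def fiberNorm (π : ℤ × ℤ → G) (u : L2) (i : G) : ℝ :=
  √(∑' n, if π n = i then ‖u n‖ ^ 2 else 0)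

theorem fiberNorm_sq (π : ℤ × ℤ → G) (u : L2) (i : G) :
    fiberNorm π u i ^ 2 = ∑' n, if π n = i then ‖u n‖ ^ 2 else 0 :=
  Real.sq_sqrt (tsum_nonneg fun n => by split_ifs <;> positivity)

theorem sum_fiberNorm_sq [Fintype G] (π : ℤ × ℤ → G) (u : L2) : ∑ i, fiberNorm π u i ^ 2 = ‖u‖ ^ 2 := by
  simp only [fiberNorm_sq]
  rw [sum_tsum_ite_eq (summable_norm_sq u), norm_sq_eq_tsum]

theorem tsum_mul_le_sqrt_mul_sqrt {f g : ℤ × ℤ → ℝ} (hf0 : ∀ n, 0 ≤ f n) (hg0 : ∀ n, 0 ≤ g n)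
    (hf : Summable fun n => f n ^ 2) (hg : Summable fun n => g n ^ 2) :
    ∑' n, f n * g n ≤ √(∑' n, f n ^ 2) * √(∑' n, g n ^ 2) := by
  have h := Real.inner_le_Lp_mul_Lq_tsum_of_nonneg Real.HolderConjugate.two_two hf0 hg0
    (by simpa using hf) (by simpa using hg)
  simpa [Real.sqrt_eq_rpow] using h

end

section

variable {G : Type*} [Fintype G] [DecidableEq G] [AddCommGroup G]

/-- Cauchy–Schwarz is applied on each fibre of π separately; translation by b carries the fibre over
i to the one over i + π b. -/
theorem norm_inner_translation_le (π : ℤ × ℤ →+ G) (b : ℤ × ℤ) (u : L2) :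
    ‖inner ℂ (translation b u) u‖ ≤ ∑ i, fiberNorm π u (i + π b) * fiberNorm π u i := by
  have hs₀ := summable_norm_sq u
  have hs₁ := summable_norm_sq (translation b u)
  have hs : Summable fun n => ‖translation b u n‖ * ‖u n‖ := by
    refine Summable.of_nonneg_of_le (fun _ => by positivity) (fun n => ?_) (hs₀.add hs₁)
    nlinarith [sq_nonneg (‖translation b u n‖ - ‖u n‖), sq_nonneg (‖translation b u n‖),
      sq_nonneg ‖u n‖]
  have hshift : ∀ i, (∑' n, if π n = i then ‖translation b u n‖ ^ 2 else 0) =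
      ∑' n, if π n = i + π b then ‖u n‖ ^ 2 else 0 := fun i => by
    rw [← (Equiv.addRight b).tsum_eq fun n => if π n = i + π b then ‖u n‖ ^ 2 else 0]
    simp
  calc ‖inner ℂ (translation b u) u‖ ≤ ∑' n, ‖translation b u n‖ * ‖u n‖ := by
        rw [lp.inner_eq_tsum]
        exact tsum_of_norm_bounded hs.hasSum fun n => norm_inner_le_norm _ _
    _ = ∑ i, ∑' n, (if π n = i then ‖translation b u n‖ * ‖u n‖ else 0) :=
        (sum_tsum_ite_eq hs π).symm
    _ ≤ _ := Finset.sum_le_sum fun i _ => by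
        have h := tsum_mul_le_sqrt_mul_sqrt
          (f := fun n => if π n = i then ‖translation b u n‖ else 0)
          (g := fun n => if π n = i then ‖u n‖ else 0)
          (fun n => by split_ifs <;> positivity) (fun n => by split_ifs <;> positivity)
          ((summable_ite_eq hs₁ π i).congr fun n => by split_ifs <;> simp)
          ((summable_ite_eq hs₀ π i).congr fun n => by split_ifs <;> simp)
        have e : ∀ f : ℤ × ℤ → ℝ, (∑' n, (if π n = i then f n else 0) ^ 2) =
            ∑' n, if π n = i then f n ^ 2 else 0 := fun f =>
          tsum_congr fun n => by split_ifs <;> simp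
        rw [e, e, hshift] at h
        refine le_trans (le_of_eq (tsum_congr fun n => ?_)) h
        split_ifs <;> simp

end

/-- Reduction modulo `(p, q)`. -/
def reduction (p q : ℕ) : ℤ × ℤ →+ ZMod p × ZMod q :=
  (Int.castAddHom (ZMod p)).prodMap (Int.castAddHom (ZMod q))

section

variable {p q : ℕ} [NeZero p] [NeZero q]

theorem re_inner_multiplication (V : LInf) {v : ZMod p × ZMod q → ℝ}
    (hV : ∀ n, V n = v (reduction p q n)) (u : L2) :
    (inner ℂ (multiplication V u) u).re = ∑ i, v i * fiberNorm (reduction p q) u i ^ 2 := by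
  have hs := summable_norm_sq u
  have e : inner ℂ (multiplication V u) u = ((∑' n, V n * ‖u n‖ ^ 2 : ℝ) : ℂ) := by
    rw [lp.inner_eq_tsum, Complex.ofReal_tsum]
    refine tsum_congr fun n => ?_
    rw [multiplication_apply, ← smul_eq_mul, inner_smul_left, Complex.conj_ofReal,
      inner_self_eq_norm_sq_to_K]
    push_cast
    rfl
  rw [e, Complex.ofReal_re]
  simp only [fiberNorm_sq, ← tsum_mul_left]
  rw [← Summable.tsum_finsetSum fun i _ => (summable_ite_eq hs _ i).mul_left _]
  refine tsum_congr fun n => ?_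
  simp [hV]

/-- The fibre norms of u form a nonnegative trial vector on the torus of the same norm. At k = 0 all
hopping coefficients are 1, so its form dominates the hopping terms of u. The absolute value lets
one estimate serve both edges, with v and with -v. -/
theorem abs_re_inner_laplacian_le (u : L2) (v : ZMod p × ZMod q → ℝ) :
    |(inner ℂ (laplacian u) u).re| + ∑ i, v i * fiberNorm (reduction p q) u i ^ 2 ≤
      topEnergy (blochMatrix 0 v) * ‖u‖ ^ 2 := by
  set W := fiberNorm (reduction p q) u
  let w : EuclideanSpace ℂ (ZMod p × ZMod q) := WithLp.toLp 2 fun i => (W i : ℂ)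
  have hw : ‖w‖ ^ 2 = ‖u‖ ^ 2 := by
    rw [EuclideanSpace.norm_sq_eq, ← sum_fiberNorm_sq (reduction p q) u]
    simp [w, W]
  have h := reApplyInnerSelf_le_topEnergy (blochMatrix 0 v) w
  rw [hw] at h
  refine le_trans ?_ h
  have hform : (Matrix.toEuclideanCLM (𝕜 := ℂ) (blochMatrix 0 v)).reApplyInnerSelf w =
      ((∑ i, W (i - (1, 0)) * W i + ∑ i, W (i + (1, 0)) * W i) +
        (∑ i, W (i - (0, 1)) * W i + ∑ i, W (i + (0, 1)) * W i)) + ∑ i, v i * W i ^ 2 := by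
    rw [ContinuousLinearMap.reApplyInnerSelf, PiLp.inner_apply, map_sum]
    simp only [← Finset.sum_add_distrib]
    refine Finset.sum_congr rfl fun i _ => ?_
    rw [Matrix.ofLp_toEuclideanCLM, blochMatrix_mulVec]
    simp [w]
    ring
  have hπ₁ : reduction p q (1, 0) = (1, 0) := by simp [reduction]
  have hπ₂ : reduction p q (0, 1) = (0, 1) := by simp [reduction]
  have l₁ := norm_inner_translation_le (reduction p q) (-(1, 0)) u
  have l₂ := norm_inner_translation_le (reduction p q) (1, 0) u
  have l₃ := norm_inner_translation_le (reduction p q) (-(0, 1)) u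
  have l₄ := norm_inner_translation_le (reduction p q) (0, 1) u
  rw [map_neg] at l₁ l₃
  simp only [hπ₁, hπ₂, ← sub_eq_add_neg] at l₁ l₂ l₃ l₄
  have hΔ : inner ℂ (laplacian u) u =
      inner ℂ (translation (-(1, 0)) u) u + inner ℂ (translation (1, 0) u) u +
        inner ℂ (translation (-(0, 1)) u) u + inner ℂ (translation (0, 1) u) u := by
    simp only [laplacian, add_apply, inner_add_left]
    ring
  have t := (Complex.abs_re_le_norm (inner ℂ (laplacian u) u)).trans
    (hΔ ▸ norm_add₄_le)
  rw [hform]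
  linarith

open scoped ComplexOrder in
/-- The spectrum lies below the top Bloch energy at quasimomentum `0`, and above its negative for
the negated potential. -/
theorem mem_Icc_of_mem_spectrum (V : LInf) {v : ZMod p × ZMod q → ℝ}
    (hV : ∀ n, V n = v (reduction p q n)) {z : ℂ} (hz : z ∈ spectrum ℂ (schrodinger V)) :
    ∃ μ ∈ Set.Icc (-topEnergy (blochMatrix 0 (-v))) (topEnergy (blochMatrix 0 v)), (μ : ℂ) = z := by
  have hsa := isSelfAdjoint_schrodinger V
  have hz' : (z.re : ℂ) = z := (hsa.mem_spectrum_eq_re hz).symm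
  have hre : ∀ u : L2, (inner ℂ (schrodinger V u) u).re =
      (inner ℂ (laplacian u) u).re + ∑ i, v i * fiberNorm (reduction p q) u i ^ 2 := fun u => by
    rw [← re_inner_multiplication V hV, ← Complex.add_re, ← inner_add_left]
    rfl
  have hsc : ∀ c : ℝ, IsSelfAdjoint (algebraMap ℂ (L2 →L[ℂ] L2) c) := fun c =>
    IsSelfAdjoint.algebraMap _ (Complex.conj_ofReal c)
  have hc : ∀ (c : ℝ) (u : L2),
      (inner ℂ (algebraMap ℂ (L2 →L[ℂ] L2) (c : ℂ) u) u).re = c * ‖u‖ ^ 2 := fun c u => by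
    rw [Algebra.algebraMap_eq_smul_one, smul_apply,
      one_apply_eq_self, inner_smul_left, Complex.conj_ofReal, Complex.re_ofReal_mul,
      inner_self_eq_norm_sq_to_K]
    norm_cast
  refine ⟨z.re, ⟨?_, ?_⟩, hz'⟩
  · set b := topEnergy (blochMatrix 0 (-v))
    have hpos : 0 ≤ algebraMap ℂ (L2 →L[ℂ] L2) (b : ℂ) + schrodinger V := by
      rw [ContinuousLinearMap.nonneg_iff_isPositive, ContinuousLinearMap.isPositive_def']
      refine ⟨(hsc b).add hsa, fun u => ?_⟩
      have h := abs_re_inner_laplacian_le u (-v)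
      have h' := neg_abs_le (inner ℂ (laplacian u) u).re
      simp only [Pi.neg_apply, neg_mul, Finset.sum_neg_distrib] at h
      change 0 ≤ (inner ℂ (algebraMap ℂ (L2 →L[ℂ] L2) (b : ℂ) u + schrodinger V u) u).re
      rw [inner_add_left, Complex.add_re, hc, hre]
      linarith
    have hm := spectrum_nonneg_of_nonneg hpos (spectrum.add_mem_add_iff.2 hz)
    have hm' := (Complex.le_def.1 hm).1
    rw [Complex.add_re, Complex.ofReal_re, Complex.zero_re] at hm'
    linarith
  · set b := topEnergy (blochMatrix 0 v)
    have hpos : 0 ≤ algebraMap ℂ (L2 →L[ℂ] L2) (b : ℂ) - schrodinger V := by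
      rw [ContinuousLinearMap.nonneg_iff_isPositive, ContinuousLinearMap.isPositive_def']
      refine ⟨(hsc b).sub hsa, fun u => ?_⟩
      have h := abs_re_inner_laplacian_le u v
      have h' := le_abs_self (inner ℂ (laplacian u) u).re
      change 0 ≤ (inner ℂ (algebraMap ℂ (L2 →L[ℂ] L2) (b : ℂ) u - schrodinger V u) u).re
      rw [inner_sub_left, Complex.sub_re, hc, hre]
      linarith
    have hsub : (b : ℂ) - z ∈
        spectrum ℂ (algebraMap ℂ (L2 →L[ℂ] L2) (b : ℂ) - schrodinger V) := by
      rw [← spectrum.singleton_sub_eq]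
      exact Set.sub_mem_sub rfl hz
    have hm := spectrum_nonneg_of_nonneg hpos hsub
    have hm' := (Complex.le_def.1 hm).1
    rw [Complex.sub_re, Complex.ofReal_re, Complex.zero_re] at hm'
    linarith

/-! ### The spectrum for small potentials -/

/-- For small periodic potentials the spectrum is the interval between the extreme Bloch energies. -/
theorem eventually_spectrum_eq (hpq : Nat.Coprime p q) :
    ∀ᶠ v : ZMod p × ZMod q → ℝ in nhds 0, ∀ V : LInf, (∀ n, V n = v (reduction p q n)) →
      ∃ a b : ℝ, a < b ∧ spectrum ℂ (schrodinger V) = Complex.ofReal '' Set.Icc a b := by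
  -- Taking m above the free top at (π/p, 0) makes the interior and edge ranges overlap; m > 0 gives
  -- a ≤ -m < m ≤ b.
  obtain ⟨m, hm₀, hm₄⟩ := exists_between (max_lt
    (topEnergy_blochMatrix_zero_lt (p := p) (q := q)) (show (0 : ℝ) < 4 by norm_num))
  obtain ⟨hm₁, hm₂⟩ := max_lt_iff.1 hm₀
  have hcont : Continuous fun v : ZMod p × ZMod q → ℝ =>
      topEnergy (blochMatrix (Real.pi / p, 0) v) :=
    continuous_topEnergy (continuous_blochMatrix.comp
      (f := fun v : ZMod p × ZMod q → ℝ => (((Real.pi / p, 0) : ℝ × ℝ), v)) (by fun_prop))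
  have hcont' : Continuous fun v : ZMod p × ZMod q → ℝ =>
      topEnergy (blochMatrix (Real.pi / p, 0) (-v)) := hcont.comp continuous_neg
  have hev : ∀ᶠ v : ZMod p × ZMod q → ℝ in nhds 0,
      topEnergy (blochMatrix (Real.pi / p, 0) v) < m :=
    hcont.continuousAt.eventually (gt_mem_nhds hm₁)
  have hev' : ∀ᶠ v : ZMod p × ZMod q → ℝ in nhds 0,
      topEnergy (blochMatrix (Real.pi / p, 0) (-v)) < m :=
    hcont'.continuousAt.eventually (gt_mem_nhds (by simpa only [neg_zero] using hm₁))
  filter_upwards [hev, hev', eventually_isBoundedEigenfunction hpq hm₄] with v h₁ h₂ h₃ V hV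
  have hVv : (V : ℤ × ℤ → ℝ) = fun n => v (n.1, n.2) := funext hV
  have hmem : ∀ z : ℂ, (∃ u, IsBoundedEigenfunction (fun n : ℤ × ℤ => v (n.1, n.2)) z u) →
      z ∈ spectrum ℂ (schrodinger V) := fun z ⟨u, hu⟩ =>
    IsBoundedEigenfunction.mem_spectrum (u := u) (by rwa [hVv])
  have hle : ∀ μ ∈ Set.Icc (-m) m, μ ∈ Set.Icc (-topEnergy (blochMatrix 0 (-v)))
      (topEnergy (blochMatrix 0 v)) := fun μ hμ => by
    obtain ⟨μ', hμ', e⟩ := mem_Icc_of_mem_spectrum V hV (hmem _ (h₃ μ hμ))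
    rwa [Complex.ofReal_inj.1 e] at hμ'
  have hl := (hle (-m) ⟨le_rfl, by linarith⟩).1
  have hr := (hle m ⟨by linarith, le_rfl⟩).2
  refine ⟨_, _, by linarith, Set.Subset.antisymm
    (fun z hz => mem_Icc_of_mem_spectrum V hV hz) ?_⟩
  rintro _ ⟨μ, ⟨hμ₁, hμ₂⟩, rfl⟩
  refine hmem _ ?_
  by_cases hlo : μ < -m
  · obtain ⟨u, hu⟩ := exists_isBoundedEigenfunction_of_topEnergy (v := -v) (μ := -μ)
      (k := (Real.pi / p, 0)) (k' := 0) (by linarith) (by linarith)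
    obtain ⟨w, hw⟩ := hu.neg
    exact ⟨w, by simpa using hw⟩
  by_cases hhi : m < μ
  · exact exists_isBoundedEigenfunction_of_topEnergy (h₁.le.trans hhi.le) hμ₂
  · exact h₃ μ ⟨not_lt.1 hlo, not_lt.1 hhi⟩

end

end BetheSommerfeld

end

theorem mainTheorem1 (p q : ℕ) (hp : 2 ≤ p) (hq : 2 ≤ q) (hpq : Nat.Coprime p q) :
    ∃ δ : ℝ, 0 < δ ∧
      ∀ (V : ℤ × ℤ → ℝ) (hV : BetheSommerfeld.IsPeriodic p q V),
        ‖hV.toLInf (Nat.zero_lt_of_lt hp) (Nat.zero_lt_of_lt hq)‖ ≤ δ →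
          ∃ a b : ℝ, a < b ∧
            spectrum ℂ (BetheSommerfeld.schrodinger
                (hV.toLInf (Nat.zero_lt_of_lt hp) (Nat.zero_lt_of_lt hq))) =
              Complex.ofReal '' Set.Icc a b := by
  have : NeZero p := ⟨by omega⟩
  have : NeZero q := ⟨by omega⟩
  obtain ⟨δ, hδ, h⟩ := Metric.nhds_basis_closedBall.eventually_iff.1
    (BetheSommerfeld.eventually_spectrum_eq hpq)
  refine ⟨δ, hδ, fun V hV hle => ?_⟩
  -- The potential on the torus is read off on the representatives 0, …, p - 1 and 0, …, q - 1, so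
  -- its norm is at most that of V.
  refine @h (fun i => V (i.1.val, i.2.val)) ?_ _ fun n => ?_
  · rw [mem_closedBall_zero_iff]
    refine (pi_norm_le_iff_of_nonneg hδ.le).2 fun i => le_trans ?_ hle
    exact lp.norm_apply_le_norm ENNReal.top_ne_zero
      (hV.toLInf (Nat.zero_lt_of_lt hp) (Nat.zero_lt_of_lt hq)) (i.1.val, i.2.val)
  · change V n = V (((n.1 : ZMod p).val : ℤ), ((n.2 : ZMod q).val : ℤ))
    rw [ZMod.val_intCast, ZMod.val_intCast, ← hV.eq_mod]
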